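/- Let $d\ge 1$. A measure-and-prepare device with $n$ outcomes on $\mathbb{C}^d$ consists of a POVM $(E_i)_{i=1}^n$ (positive semidefinite $d\times d$ matrices with $\sum_i E_i=I$) and density matrices $(S_i)_{i=1}^n$; its channel is $\mathcal{C}(X)=\sum_i \operatorname{tr}(E_iX)\,S_i$ and its biases are $w_i=\operatorname{tr}(E_i)/d$. The channel is depolarizing with parameter $p\in\mathbb{R}$ if $\mathcal{C}(X)=pX+(1-p)\operatorname{tr}(X)\,I/d$ for all $X$. The device is pure if every $S_i$ is $|\psi_i\rangle\langle\psi_i|$ for some unit vector $\psi_i$; its states are proportional to the effects if $E_i=\operatorname{tr}(E_i)\,S_i$ for all $i$; it is an (informationally complete) reference device if the effects, and also the states, span the real vector space of Hermitian $d\times d$ matrices. Its measurement is weight-morphophoric if there is $k>0$ with $\sum_i w_i^{-1}\operatorname{tr}(E_iX)^2=k\operatorname{tr}(X^2)$ for all traceless Hermitian $X$ (outcomes with $E_i=0$ contribute $0$). A weighted complex projective 2-design is a family of pure states $S_i$ with weights $w_i\ge 0$, $\sum_i w_i=1$, such that $\sum_i w_i\,S_i\otimes S_i=\int |\psi\rangle\langle\psi|^{\otimes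 2}\,d\psi$, where $d\psi$ is the uniform (unitarily invariant) probability measure on the unit sphere of $\mathbb{C}^d$. Let $\Pi_{\mathrm{sym}^2}=\tfrac12(I+\mathrm{SWAP})$ be the projector onto the symmetric subspace of $\mathbb{C}^d\otimes\mathbb{C}^d$. Theorem. 1. $\int |\psi\rangle\langle\psi|^{\otimes 2}\,d\psi=\frac{2}{d(d+1)}\Pi_{\mathrm{sym}^2}$. 2. For every pure measure-and-prepare device whose states are proportional to the effects: (a) if the channel is depolarizing with parameter $1/\alpha$, then $\alpha=d+1$ (provided $d\ge2$), $\sum_i w_i\,S_i\otimes S_i=\frac{2}{d(d+1)}\Pi_{\mathrm{sym}^2}$, and $(w_i,S_i)$ is a weighted complex projective 2-design; (b) the measurement is weight-morphophoric if and only if the channel is depolarizing with parameter $1/\alpha$ for some real $\alpha\neq0$. 3. Pure weight-morphophoric reference devices with states proportional to the effects are exactly weighted complex projective 2-designs: for every family of real numbers $w_i$ and $d\times d$ matrices $S_i$ ($1\le i\le n$), $(w_i,S_i)$ is a weighted complex projective 2-design if and only if there is a (then unique) pure weight-morphophoric reference device with states $S_i$ proportional to the effects and biases $w_i$. -/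

import Mathlib

open scoped ComplexOrder Kronecker

noncomputable section

/-- The rank-one operator `|ψ⟩⟨ψ|` on `ℂ^d`. -/
def ketBra {d : ℕ} (ψ : EuclideanSpace ℂ (Fin d)) : Matrix (Fin d) (Fin d) ℂ :=
  Matrix.of fun i j => ψ i * star (ψ j)

/-- A density matrix: positive semidefinite with trace one. -/
def IsDensityMatrix {d : ℕ} (ρ : Matrix (Fin d) (Fin d) ℂ) : Prop :=
  ρ.PosSemidef ∧ ρ.trace = 1

/-- A pure state: `ρ = |ψ⟩⟨ψ|` for a unit vector `ψ`. -/
def IsPureState {d : ℕ} (ρ : Matrix (Fin d) (Fin d) ℂ) : Prop :=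
  ∃ ψ : EuclideanSpace ℂ (Fin d), ‖ψ‖ = 1 ∧ ρ = ketBra ψ

/-- A measure-and-prepare device with `n` outcomes on a `d`-dimensional quantum system: a POVM
`effect`, together with a density matrix `state i` that is prepared when outcome `i` is obtained. -/
@[ext]
structure MeasurePrepareDevice (n d : ℕ) where
  effect : Fin n → Matrix (Fin d) (Fin d) ℂ
  state : Fin n → Matrix (Fin d) (Fin d) ℂ
  effect_posSemidef : ∀ i, (effect i).PosSemidef
  sum_effect : ∑ i, effect i = 1
  state_isDensityMatrix : ∀ i, IsDensityMatrix (state i)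

namespace MeasurePrepareDevice

variable {n d : ℕ} (D : MeasurePrepareDevice n d)

/-- The biases `w_i = tr(E_i) / d` (the trace of a positive semidefinite matrix is real). -/
def weight (i : Fin n) : ℝ := (D.effect i).trace.re / d

/-- Informational completeness: the effects span the real vector space of Hermitian matrices,
and so do the states. A device with this property is a reference device. -/
def IsInformationallyComplete : Prop :=
  Submodule.span ℝ (Set.range D.effect) =
      selfAdjoint.submodule ℝ (Matrix (Fin d) (Fin d) ℂ) ∧
    Submodule.span ℝ (Set.range D.state) =
      selfAdjoint.submodule ℝ (Matrix (Fin d) (Fin d) ℂ)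

/-- All prepared states are pure. -/
def IsPure : Prop := ∀ i, IsPureState (D.state i)

/-- The prepared states are proportional to the effects: `E_i = tr(E_i) S_i`. -/
def IsParallelUpdate : Prop := ∀ i, D.effect i = (D.effect i).trace • D.state i

/-- The channel `∑ i, |S_i)(E_i|` of the device, `X ↦ ∑ i, tr(E_i X) S_i`. -/
def channel (X : Matrix (Fin d) (Fin d) ℂ) : Matrix (Fin d) (Fin d) ℂ :=
  ∑ i, (D.effect i * X).trace • D.state i

/-- The channel is depolarizing with parameter `p`: it is `p I + (1 - p) |I)(I| / (I|I)`, that is,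
`X ↦ p X + (1 - p) tr(X) I / d`. -/
def IsDepolarizing (p : ℝ) : Prop :=
  ∀ X : Matrix (Fin d) (Fin d) ℂ,
    D.channel X = (p : ℂ) • X + ((1 - (p : ℂ)) * (X.trace / d)) • 1

/-- The measurement is weight-morphophoric: with respect to the diagonal metric given by the
reciprocals of the biases, the measurement map `X ↦ (tr(E_i X))_i` on the space of traceless
Hermitian matrices preserves Hilbert-Schmidt distances up to a positive constant factor
(`Z W⁻¹ Z† = k I` in Bloch form). An outcome with bias `0` has the effect `0`, and its term
in the sum is `0`. -/
def IsWeightMorphophoric : Prop :=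
  ∃ k : ℝ, 0 < k ∧ ∀ X : Matrix (Fin d) (Fin d) ℂ, X.IsHermitian → X.trace = 0 →
    ∑ i, ((D.effect i * X).trace.re) ^ 2 / D.weight i = k * (X * X).trace.re

/-- A pure weight-morphophoric reference device: informationally complete, with pure states
proportional to the effects, and with a weight-morphophoric measurement. -/
def IsPureWeightMorphophoricReferenceDevice : Prop :=
  D.IsInformationallyComplete ∧ D.IsPure ∧ D.IsParallelUpdate ∧ D.IsWeightMorphophoric

end MeasurePrepareDevice

/-- The operator on `ℂ^d ⊗ ℂ^d` that exchanges the two tensor factors. -/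
def swapMatrix (d : ℕ) : Matrix (Fin d × Fin d) (Fin d × Fin d) ℂ :=
  Matrix.of fun p q => if p.1 = q.2 ∧ p.2 = q.1 then 1 else 0

/-- The orthogonal projector onto the symmetric subspace of `ℂ^d ⊗ ℂ^d`. -/
def symProjector (d : ℕ) : Matrix (Fin d × Fin d) (Fin d × Fin d) ℂ :=
  (1 / 2 : ℂ) • (1 + swapMatrix d)

/-- The uniform (unitarily invariant) probability measure on the unit sphere of `ℂ^d`. -/
def uniformSphere (d : ℕ) :
    MeasureTheory.Measure (Metric.sphere (0 : EuclideanSpace ℂ (Fin d)) 1) :=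
  ((MeasureTheory.volume : MeasureTheory.Measure (EuclideanSpace ℂ (Fin d))).toSphere
      Set.univ)⁻¹ •
    (MeasureTheory.volume : MeasureTheory.Measure (EuclideanSpace ℂ (Fin d))).toSphere

/-- The average `∫ |ψ⟩⟨ψ| ⊗ |ψ⟩⟨ψ| dψ` over all pure states, taken entrywise. -/
def haarAverage (d : ℕ) : Matrix (Fin d × Fin d) (Fin d × Fin d) ℂ :=
  Matrix.of fun p q => ∫ ψ, (ketBra ψ.1 ⊗ₖ ketBra ψ.1) p q ∂(uniformSphere d)

/-- A weighted complex projective 2-design: pure states `S_i` with non-negative weights `w_i` of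
sum one whose weighted average of `S_i ⊗ S_i` is the average over all pure states. -/
def IsWeightedProjectiveTwoDesign {n d : ℕ} (w : Fin n → ℝ)
    (S : Fin n → Matrix (Fin d) (Fin d) ℂ) : Prop :=
  (∀ i, 0 ≤ w i) ∧ ∑ i, w i = 1 ∧ (∀ i, IsPureState (S i)) ∧
    ∑ i, (w i : ℂ) • (S i ⊗ₖ S i) = haarAverage d

end

/-! Part 1 is a computation of fourth moments. Phase invariance kills every moment except those with
`{a, c} = {b, e}` as multisets, permutations identify the survivors up to two values, one reflection
shows that the diagonal value is twice the other, and normalization fixes the scale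
(`sphereMoment_eq`). Contracting one tensor factor with `X` turns the design identity into a frame
formula: `∑ w_i tr(S_i X) S_i` is proportional to `X + tr(X) 1`
(`sum_kronecker_eq_symProjector_iff`). For states proportional to the effects, `E_i = d w_i S_i`, so
the channel is `d` times this frame operator, and being a design means being depolarizing with
parameter `1/(d+1)`. No other parameter can occur when `d ≥ 2`: purity makes the superoperator trace
of the channel equal to `d` (`param_eq`). Weight-morphophoricity prescribes the quadratic form of
the channel on traceless Hermitian matrices, and polarization recovers the channel from it.
Conversely, a design yields a device through `E_i = d w_i S_i`, and the frame formula, solved for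
`X`, gives informational completeness. -/

open scoped ComplexOrder Kronecker

noncomputable section

/-! ### Fourth moments of the uniform measure on the unit sphere. -/

section UniformSphere

open MeasureTheory Metric
open scoped Pointwise

/-- The homeomorphism of the unit sphere induced by a linear isometry. -/
def LinearIsometryEquiv.unitSphereHomeomorph {E : Type*} [NormedAddCommGroup E] [NormedSpace ℝ E]
    (U : E ≃ₗᵢ[ℝ] E) : sphere (0 : E) 1 ≃ₜ sphere (0 : E) 1 where
  toFun x := ⟨U x, by simp⟩
  invFun x := ⟨U.symm x, by simp⟩
  left_inv x := by simp
  right_inv x := by simp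
  continuous_toFun := by fun_prop
  continuous_invFun := by fun_prop

/-- The spherical measure of `s` is a multiple of the volume of the cone `(0, 1) • s`, and
isometries carry cones to cones of the same volume. -/
theorem LinearIsometryEquiv.measurePreserving_toSphere {E : Type*} [NormedAddCommGroup E]
    [InnerProductSpace ℝ E] [FiniteDimensional ℝ E] [MeasurableSpace E] [BorelSpace E]
    (U : E ≃ₗᵢ[ℝ] E) :
    MeasurePreserving U.unitSphereHomeomorph (volume : Measure E).toSphere
      (volume : Measure E).toSphere := by
  refine ⟨U.unitSphereHomeomorph.measurable, ?_⟩
  ext s hs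
  rw [Measure.map_apply U.unitSphereHomeomorph.measurable hs, Measure.toSphere_apply' _ hs,
    Measure.toSphere_apply' _ (U.unitSphereHomeomorph.measurable hs)]
  congr 1
  have h : Set.Ioo (0 : ℝ) 1 • (Subtype.val '' (U.unitSphereHomeomorph ⁻¹' s)) =
      U.toMeasurableEquiv ⁻¹' (Set.Ioo (0 : ℝ) 1 • (Subtype.val '' s)) := by
    ext x
    simp only [Set.mem_smul, Set.mem_preimage, Set.mem_image]
    constructor
    · rintro ⟨r, hr, _, ⟨y, hy, rfl⟩, rfl⟩
      exact ⟨r, hr, _, ⟨_, hy, rfl⟩, by simp [LinearIsometryEquiv.unitSphereHomeomorph]⟩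
    · rintro ⟨r, hr, _, ⟨y, hy, rfl⟩, h⟩
      refine ⟨r, hr, _, ⟨U.unitSphereHomeomorph.symm y, by simpa using hy, rfl⟩, ?_⟩
      apply U.injective
      rw [map_smul]
      simpa [LinearIsometryEquiv.unitSphereHomeomorph] using h
  rw [h]
  exact U.measurePreserving.measure_preimage_equiv (f := U.toMeasurableEquiv) _

variable {d : ℕ}

theorem integral_uniformSphere_comp (U : EuclideanSpace ℂ (Fin d) ≃ₗᵢ[ℝ] EuclideanSpace ℂ (Fin d))
    (f : EuclideanSpace ℂ (Fin d) → ℂ) :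
    ∫ ψ, f (U ψ.1) ∂(uniformSphere d) = ∫ ψ, f ψ.1 ∂(uniformSphere d) := by
  simp only [uniformSphere, integral_smul_measure]
  congr 1
  exact U.measurePreserving_toSphere.integral_comp U.unitSphereHomeomorph.measurableEmbedding
    (fun ψ => f ψ.1)

theorem isProbabilityMeasure_uniformSphere (hd : 1 ≤ d) :
    IsProbabilityMeasure (uniformSphere d) := by
  have : Nonempty (Fin d) := ⟨⟨0, hd⟩⟩
  refine ⟨?_⟩
  rw [uniformSphere, Measure.smul_apply, smul_eq_mul]
  refine ENNReal.inv_mul_cancel ?_ (measure_ne_top _ _)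
  rw [Ne, Measure.measure_univ_eq_zero]
  exact Measure.toSphere_ne_zero _

/-- The fourth moments of the uniform measure on the unit sphere. -/
def sphereMoment (a c b e : Fin d) : ℂ :=
  ∫ ψ, (ψ.1 a * ψ.1 c * (star (ψ.1 b) * star (ψ.1 e)) : ℂ) ∂(uniformSphere d)

theorem integrable_sphereMoment (hd : 1 ≤ d) (a c b e : Fin d) :
    Integrable (fun ψ : sphere (0 : EuclideanSpace ℂ (Fin d)) 1 =>
      (ψ.1 a * ψ.1 c * (star (ψ.1 b) * star (ψ.1 e)) : ℂ)) (uniformSphere d) := by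
  have := isProbabilityMeasure_uniformSphere hd
  refine Continuous.integrable_of_hasCompactSupport (by fun_prop) ?_
  exact HasCompactSupport.of_compactSpace _

theorem sphereMoment_phase (u : Fin d → Circle) (a c b e : Fin d) :
    sphereMoment a c b e =
      (u a * u c * (star (u b : ℂ) * star (u e : ℂ)) : ℂ) * sphereMoment a c b e := by
  have h := integral_uniformSphere_comp
    (LinearIsometryEquiv.piLpCongrRight 2 fun i : Fin d => rotation (u i))
    (fun ψ => ψ a * ψ c * (star (ψ b) * star (ψ e)))
  refine h.symm.trans ?_
  rw [sphereMoment, ← integral_const_mul]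
  simp only [LinearIsometryEquiv.piLpCongrRight_apply, rotation_apply, star_mul]
  refine integral_congr_ae (Filter.Eventually.of_forall fun ψ => ?_)
  simp only
  ring

theorem sphereMoment_perm (σ : Equiv.Perm (Fin d)) (a c b e : Fin d) :
    sphereMoment (σ a) (σ c) (σ b) (σ e) = sphereMoment a c b e :=
  integral_uniformSphere_comp (LinearIsometryEquiv.piLpCongrLeft 2 ℝ ℂ σ.symm)
    (fun ψ => ψ a * ψ c * (star (ψ b) * star (ψ e)))

theorem sphereMoment_eq_zero {a c b e : Fin d} (h : ¬ (a = b ∧ c = e)) (h' : ¬ (a = e ∧ c = b)) :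
    sphereMoment a c b e = 0 := by
  by_contra h0
  -- Putting the phase `i` on the coordinate `j` alone shows that `j` occurs equally often modulo 4
  -- in `(a, c)` and in `(b, e)`, hence equally often. The phase `-1` would not separate `a = c`
  -- from `b = e`.
  obtain ⟨z, hz⟩ : ∃ z : Circle, (z : ℂ) = Complex.I :=
    ⟨⟨Complex.I, mem_sphere_zero_iff_norm.2 Complex.norm_I⟩, rfl⟩
  have key (j : Fin d) :
      (if a = j then Complex.I else 1) * (if c = j then Complex.I else 1) *
        ((if b = j then -Complex.I else 1) * (if e = j then -Complex.I else 1)) = 1 := by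
    have hk := sphereMoment_phase (fun i => if i = j then z else 1) a c b e
    rw [right_eq_mul₀ h0] at hk
    convert hk using 2 <;> congr 1 <;> split_ifs <;> simp [hz]
  have k1 := key a
  have k2 := key c
  have k3 := key b
  have k4 := key e
  clear key h0
  have hI := Complex.I_mul_I
  grind

/-- The reflection in the line spanned by `e_a + 2 e_b`. -/
theorem exists_isometry_coord {a b : Fin d} (hab : a ≠ b) :
    ∃ U : EuclideanSpace ℂ (Fin d) ≃ₗᵢ[ℝ] EuclideanSpace ℂ (Fin d),
      ∀ ψ, (U ψ) a = (-3 / 5) * ψ a + (4 / 5) * ψ b := by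
  let v : EuclideanSpace ℂ (Fin d) := EuclideanSpace.single a 1 + EuclideanSpace.single b 2
  have hv : ‖v‖ ^ 2 = 5 := by
    rw [norm_add_sq (𝕜 := ℂ)]
    simp [hab, EuclideanSpace.inner_single_left]
    norm_num
  let R := (Submodule.span ℂ {v}).reflection
  refine ⟨{ R.toLinearEquiv.restrictScalars ℝ with norm_map' := R.norm_map }, fun ψ => ?_⟩
  change (R ψ) a = _
  have hv' : (‖v‖ : ℂ) ^ 2 = 5 := by exact_mod_cast hv
  simp only [R]
  rw [Submodule.reflection_singleton_apply]
  simp only [RCLike.ofReal_eq_complex_ofReal, hv']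
  simp [v, hab, inner_add_left, EuclideanSpace.inner_single_left,
    show (starRingEnd ℂ) 2 = 2 from map_ofNat _ 2]
  ring

/-- With `p = -3/5`, `q = 4/5`, invariance of the fourth moment of `p ψ_a + q ψ_b` reads `A = (p⁴ +
q⁴) A + 4 p² q² B`, where `A` is the diagonal and `B` the mixed moment. Since `1 - p⁴ - q⁴ = 2 p²
q²`, this gives `A = 2 B`. -/
theorem sphereMoment_self (hd : 1 ≤ d) {a b : Fin d} (hab : a ≠ b) :
    sphereMoment a a a a = 2 * sphereMoment a b a b := by
  obtain ⟨U, hU⟩ := exists_isometry_coord hab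
  have h := integral_uniformSphere_comp U (fun ψ => ψ a * ψ a * (star (ψ a) * star (ψ a)))
  have hi := integrable_sphereMoment hd
  have e1 : ∫ ψ, ((U ψ.1) a * (U ψ.1) a * (star ((U ψ.1) a) * star ((U ψ.1) a)) : ℂ)
        ∂(uniformSphere d) =
      ∑ i : Fin 2, ∑ j : Fin 2, ∑ k : Fin 2, ∑ l : Fin 2,
        (![-3 / 5, 4 / 5] i * ![-3 / 5, 4 / 5] j * (![-3 / 5, 4 / 5] k * ![-3 / 5, 4 / 5] l)) *
          sphereMoment (![a, b] i) (![a, b] j) (![a, b] k) (![a, b] l) := by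
    simp only [sphereMoment, ← integral_const_mul]
    have hi' (i j k l : Fin 2) := (hi (![a, b] i) (![a, b] j) (![a, b] k) (![a, b] l)).const_mul
      ((![-3 / 5, 4 / 5] i * ![-3 / 5, 4 / 5] j * (![-3 / 5, 4 / 5] k * ![-3 / 5, 4 / 5] l)) : ℂ)
    have h1 i j k := integrable_finsetSum Finset.univ fun l _ => hi' i j k l
    have h2 i j := integrable_finsetSum Finset.univ fun k _ => h1 i j k
    have h3 i := integrable_finsetSum Finset.univ fun j _ => h2 i j
    simp_rw [← integral_finsetSum Finset.univ fun l _ => hi' _ _ _ l]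
    simp_rw [← integral_finsetSum Finset.univ fun k _ => h1 _ _ k]
    simp_rw [← integral_finsetSum Finset.univ fun j _ => h2 _ j]
    rw [← integral_finsetSum Finset.univ fun i _ => h3 i]
    refine integral_congr_ae (Filter.Eventually.of_forall fun ψ => ?_)
    simp [hU, Fin.sum_univ_two]
    ring
  have h1 : sphereMoment b b b b = sphereMoment a a a a := by
    simpa using sphereMoment_perm (Equiv.swap a b) a a a a
  have h2 : sphereMoment b a b a = sphereMoment a b a b := by
    simpa [hab.symm] using sphereMoment_perm (Equiv.swap a b) a b a b
  have h3 : sphereMoment b a a b = sphereMoment a b a b := by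
    simp only [sphereMoment]; congr 1; ext; ring
  have h4 : sphereMoment a b b a = sphereMoment a b a b := by
    simp only [sphereMoment]; congr 1; ext; ring
  rw [e1] at h
  change _ = sphereMoment a a a a at h
  simp [Fin.sum_univ_two, h1, h2, h3, h4, sphereMoment_eq_zero, hab, hab.symm] at h
  linear_combination (-625 / 288) * h

theorem sum_sphereMoment (hd : 1 ≤ d) : ∑ a : Fin d, ∑ b : Fin d, sphereMoment a b a b = 1 := by
  have := isProbabilityMeasure_uniformSphere hd
  have h (ψ : sphere (0 : EuclideanSpace ℂ (Fin d)) 1) :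
      ∑ a : Fin d, ∑ b : Fin d, (ψ.1 a * ψ.1 b * (star (ψ.1 a) * star (ψ.1 b)) : ℂ) = 1 := by
    have h1 : ∑ a : Fin d, (ψ.1 a * star (ψ.1 a) : ℂ) = 1 := by
      have h2 : ‖ψ.1‖ ^ 2 = 1 := by simp
      rw [EuclideanSpace.norm_sq_eq] at h2
      simp only [Complex.star_def, Complex.mul_conj, Complex.normSq_eq_norm_sq]
      exact_mod_cast h2
    calc _ = (∑ a : Fin d, (ψ.1 a * star (ψ.1 a) : ℂ)) * ∑ b : Fin d, ψ.1 b * star (ψ.1 b) := by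
          rw [Finset.sum_mul_sum]
          refine Finset.sum_congr rfl fun a _ => Finset.sum_congr rfl fun b _ => by ring
      _ = 1 := by rw [h1, one_mul]
  simp only [sphereMoment]
  simp_rw [← integral_finsetSum _ fun b _ => integrable_sphereMoment hd _ b _ b]
  rw [← integral_finsetSum _ fun a _ =>
    integrable_finsetSum _ fun b _ => integrable_sphereMoment hd a b a b]
  simp_rw [h]
  simp

theorem sphereMoment_eq (hd : 1 ≤ d) (a c b e : Fin d) :
    sphereMoment a c b e = 1 / ((d : ℂ) * (d + 1)) *
      ((if a = b ∧ c = e then 1 else 0) + if a = e ∧ c = b then 1 else 0) := by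
  let z : Fin d := ⟨0, hd⟩
  have hself (a : Fin d) : sphereMoment a a a a = sphereMoment z z z z := by
    simpa using sphereMoment_perm (Equiv.swap z a) z z z z
  have hpair (a b : Fin d) :
      sphereMoment a b a b = sphereMoment z z z z / 2 * (1 + if a = b then 1 else 0) := by
    split_ifs with h
    · rw [← h, hself]; ring
    · rw [← hself a, sphereMoment_self hd h]; ring
  have hsum := sum_sphereMoment hd
  have hd0 : (d : ℂ) ≠ 0 := by exact_mod_cast (by lia : d ≠ 0)
  have hd1 : (d : ℂ) + 1 ≠ 0 := by exact_mod_cast d.succ_ne_zero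
  -- Summing `m (1 + δ_ab)` over all pairs gives `m (d² + d)`, and the total is `1`.
  have hz : sphereMoment z z z z / 2 = 1 / ((d : ℂ) * (d + 1)) := by
    generalize sphereMoment z z z z / 2 = m at hpair
    simp only [hpair, ← Finset.mul_sum, Finset.sum_add_distrib] at hsum
    refine (eq_div_iff (mul_ne_zero hd0 hd1)).2 (Eq.trans ?_ hsum)
    simp [mul_add]
  have hcomm : sphereMoment a c c a = sphereMoment a c a c := by
    simp only [sphereMoment]; congr 1; ext; ring
  by_cases h : a = b ∧ c = e
  · obtain ⟨rfl, rfl⟩ := h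
    rw [hpair, hz]
    rcases eq_or_ne a c with rfl | h
    · simp
    · simp [h]
  by_cases h' : a = e ∧ c = b
  · obtain ⟨rfl, rfl⟩ := h'
    rw [hcomm, hpair, hz]
    rcases eq_or_ne a c with rfl | h
    · simp
    · rw [if_neg h, if_neg fun hac => h hac.1, if_pos ⟨rfl, rfl⟩]
      ring
  rw [sphereMoment_eq_zero h h', if_neg h, if_neg h']
  simp

end UniformSphere

/-! ### The symmetric projector, pure states and frame operators. -/

theorem symProjector_apply {d : ℕ} (a c b e : Fin d) :
    symProjector d (a, c) (b, e) =
      1 / 2 * ((if a = b ∧ c = e then 1 else 0) + if a = e ∧ c = b then 1 else 0) := by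
  simp [symProjector, swapMatrix, Matrix.one_apply]

theorem haarAverage_eq {d : ℕ} (hd : 1 ≤ d) :
    haarAverage d = (2 / ((d : ℂ) * (d + 1))) • symProjector d := by
  ext ⟨a, c⟩ ⟨b, e⟩
  rw [Matrix.smul_apply, symProjector_apply]
  trans sphereMoment a c b e
  · simp only [haarAverage, sphereMoment, Matrix.of_apply, Matrix.kroneckerMap_apply, ketBra]
    congr 1
    ext ψ
    ring
  · rw [sphereMoment_eq hd, smul_eq_mul]
    ring

theorem IsPureState.isDensityMatrix {d : ℕ} {S : Matrix (Fin d) (Fin d) ℂ} (h : IsPureState S) :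
    IsDensityMatrix S := by
  obtain ⟨ψ, hψ, rfl⟩ := h
  refine ⟨Matrix.posSemidef_vecMulVec_self_star ψ.ofLp, ?_⟩
  have h2 : ‖ψ‖ ^ 2 = 1 := by simp [hψ]
  rw [EuclideanSpace.norm_sq_eq] at h2
  simp only [ketBra, Matrix.trace, Matrix.diag, Matrix.of_apply, Complex.star_def,
    Complex.mul_conj, Complex.normSq_eq_norm_sq]
  exact_mod_cast h2

theorem IsPureState.mul_self {d : ℕ} {S : Matrix (Fin d) (Fin d) ℂ} (h : IsPureState S) :
    S * S = S := by
  have ht := h.isDensityMatrix.2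
  obtain ⟨ψ, -, rfl⟩ := h
  ext i j
  simp only [ketBra, Matrix.trace, Matrix.diag, Matrix.of_apply, Matrix.mul_apply] at ht ⊢
  calc _ = ψ i * star (ψ j) * ∑ k, ψ k * star (ψ k) := by
        rw [Finset.mul_sum]
        exact Finset.sum_congr rfl fun k _ => by ring
    _ = _ := by rw [ht, mul_one]

theorem Matrix.IsHermitian.ofReal_re_trace_mul {m : Type*} [Fintype m] {A B : Matrix m m ℂ}
    (hA : A.IsHermitian) (hB : B.IsHermitian) : ((A * B).trace.re : ℂ) = (A * B).trace := by
  rw [← Complex.conj_eq_iff_re, ← Complex.star_def, ← Matrix.trace_conjTranspose,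
    Matrix.conjTranspose_mul, hA.eq, hB.eq, Matrix.trace_mul_comm]

/-- A weighted family has the second moment of the uniform measure if and only if its frame
operator is a combination of the identity and the trace. -/
theorem sum_kronecker_eq_symProjector_iff {n d : ℕ} (w : Fin n → ℂ)
    (S : Fin n → Matrix (Fin d) (Fin d) ℂ) :
    ∑ i, w i • (S i ⊗ₖ S i) = (2 / ((d : ℂ) * (d + 1))) • symProjector d ↔
      ∀ X : Matrix (Fin d) (Fin d) ℂ, ∑ i, (w i * (S i * X).trace) • S i =
        (1 / ((d : ℂ) * (d + 1))) • (X + X.trace • 1) := by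
  have hentry (a b c e : Fin d) :
      (∑ i, w i • (S i ⊗ₖ S i)) (a, c) (b, e) = ∑ i, w i * (S i a b * S i c e) := by
    simp [Matrix.sum_apply]
  constructor
  · intro h X
    ext c e
    have h' (a b : Fin d) : ∑ i, w i * (S i a b * S i c e) = 1 / ((d : ℂ) * (d + 1)) *
        ((if a = b ∧ c = e then 1 else 0) + if a = e ∧ c = b then 1 else 0) := by
      rw [← hentry, h, Matrix.smul_apply, symProjector_apply, smul_eq_mul]
      ring
    -- The first tensor factor is contracted with `X`: the identity contributes `tr(X) 1` and the
    -- swap contributes `X`.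
    calc _ = ∑ a, ∑ b, X b a * ∑ i, w i * (S i a b * S i c e) := by
          simp only [Matrix.sum_apply, Matrix.smul_apply, Matrix.trace, Matrix.diag,
            Matrix.mul_apply, smul_eq_mul, Finset.mul_sum, Finset.sum_mul]
          rw [Finset.sum_comm]
          refine Finset.sum_congr rfl fun a _ => ?_
          rw [Finset.sum_comm]
          exact Finset.sum_congr rfl fun b _ => Finset.sum_congr rfl fun i _ => by ring
      _ = _ := by
          simp only [h', mul_add, Finset.sum_add_distrib, ite_and, mul_ite, mul_zero, mul_one,
            Finset.sum_ite_eq, Finset.mem_univ, if_true, Matrix.smul_apply, Matrix.add_apply,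
            Matrix.one_apply, Matrix.trace, Matrix.diag, smul_eq_mul, Finset.sum_ite_irrel,
            Finset.sum_const_zero, Finset.sum_ite_eq', ← Finset.sum_mul]
          split_ifs <;> ring
  · intro h
    ext ⟨a, c⟩ ⟨b, e⟩
    -- Matrix units recover the individual entries of the first tensor factor.
    have h' := congrFun (congrFun (h (Matrix.single b a 1)) c) e
    simp only [Matrix.sum_apply, Matrix.smul_apply, Matrix.trace_mul_single, MulOpposite.op_one,
      one_smul, smul_eq_mul] at h'
    rw [hentry, Matrix.smul_apply, symProjector_apply, smul_eq_mul]
    calc _ = _ := Finset.sum_congr rfl fun i _ => by ring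
      _ = _ := h'
      _ = _ := ?_
    have htr : (Matrix.single b a (1 : ℂ)).trace = if a = b then 1 else 0 := by
      rcases eq_or_ne a b with rfl | hab
      · simp
      · rw [Matrix.trace_single_eq_of_ne _ _ _ hab.symm, if_neg hab]
    simp only [Matrix.add_apply, Matrix.smul_apply, Matrix.one_apply, Matrix.single_apply,
      htr, smul_eq_mul, ite_and, eq_comm (a := c), mul_ite, mul_one, mul_zero]
    split_ifs <;> ring

/-- A self-adjoint superoperator whose quadratic form vanishes on Hermitian matrices is zero. -/
theorem Matrix.superoperator_eq_zero {m : Type*} [Fintype m] [DecidableEq m]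
    (T : Matrix m m ℂ →ₗ[ℂ] Matrix m m ℂ)
    (hT : ∀ X Y, (T X * Y).trace = (T Y * X).trace)
    (h0 : ∀ X : Matrix m m ℂ, X.IsHermitian → (T X * X).trace = 0) : T = 0 := by
  have h1 (X Y : Matrix m m ℂ) (hX : X.IsHermitian) (hY : Y.IsHermitian) :
      (T X * Y).trace = 0 := by
    -- Polarization, with the symmetry `hT` merging the two cross terms.
    have h := h0 (X + Y) (hX.add hY)
    simp only [map_add, add_mul, mul_add, Matrix.trace_add, h0 X hX, h0 Y hY, hT Y X] at h
    linear_combination h / 2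
  have h2 (X Y : Matrix m m ℂ) : (T X * Y).trace = 0 := by
    have hre (Z : Matrix m m ℂ) : (realPart Z : Matrix m m ℂ).IsHermitian := (realPart Z).2
    have him (Z : Matrix m m ℂ) : (imaginaryPart Z : Matrix m m ℂ).IsHermitian := (imaginaryPart Z).2
    rw [← realPart_add_I_smul_imaginaryPart X, ← realPart_add_I_smul_imaginaryPart Y]
    simp only [map_add, map_smul, add_mul, mul_add, Matrix.trace_add, Matrix.smul_mul,
      Matrix.mul_smul, Matrix.trace_smul, h1 _ _ (hre _) (hre _), h1 _ _ (hre _) (him _),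
      h1 _ _ (him _) (hre _), h1 _ _ (him _) (him _), smul_zero, add_zero]
  ext X a b
  simpa [Matrix.trace_mul_single] using h2 X (Matrix.single b a 1)

/-! ### Channels of devices with states proportional to the effects. -/

namespace MeasurePrepareDevice

variable {n d : ℕ} {D : MeasurePrepareDevice n d}

theorem trace_effect (hd : 1 ≤ d) (i : Fin n) : (D.effect i).trace = (d : ℂ) * D.weight i := by
  have hd0 : (d : ℂ) ≠ 0 := by exact_mod_cast (by lia : d ≠ 0)
  have him : ((D.effect i).trace.re : ℂ) = (D.effect i).trace :=
    (Complex.eq_re_of_ofReal_le (D.effect_posSemidef i).trace_nonneg).symm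
  rw [weight, Complex.ofReal_div, him, Complex.ofReal_natCast, mul_div_cancel₀ _ hd0]

theorem weight_nonneg (i : Fin n) : 0 ≤ D.weight i :=
  div_nonneg (Complex.nonneg_iff.1 (D.effect_posSemidef i).trace_nonneg).1 d.cast_nonneg

theorem sum_weight (hd : 1 ≤ d) : ∑ i, D.weight i = 1 := by
  have hd0 : (d : ℝ) ≠ 0 := by exact_mod_cast (by lia : d ≠ 0)
  have h := congrArg (fun A => (Matrix.trace A).re) D.sum_effect
  simp only [Matrix.trace_sum, Complex.re_sum, Matrix.trace_one, Fintype.card_fin,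
    Complex.natCast_re] at h
  simp only [weight]
  rw [← Finset.sum_div, h, div_self hd0]

theorem IsParallelUpdate.effect_eq (h : D.IsParallelUpdate) (hd : 1 ≤ d) (i : Fin n) :
    D.effect i = ((d : ℂ) * D.weight i) • D.state i := by
  rw [← trace_effect hd]
  exact h i

theorem channel_eq (h : D.IsParallelUpdate) (hd : 1 ≤ d) (X : Matrix (Fin d) (Fin d) ℂ) :
    D.channel X = (d : ℂ) • ∑ i, (D.weight i * (D.state i * X).trace) • D.state i := by
  rw [channel, Finset.smul_sum]
  refine Finset.sum_congr rfl fun i _ => ?_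
  rw [h.effect_eq hd i, Matrix.smul_mul, Matrix.trace_smul, smul_smul, smul_eq_mul, mul_assoc]

/-- The channel as a linear map. -/
def channelLinearMap (D : MeasurePrepareDevice n d) :
    Matrix (Fin d) (Fin d) ℂ →ₗ[ℂ] Matrix (Fin d) (Fin d) ℂ where
  toFun := D.channel
  map_add' X Y := by
    simp [channel, mul_add, add_smul, Finset.sum_add_distrib]
  map_smul' c X := by
    simp [channel, Finset.smul_sum, smul_smul]

theorem trace_channel (X : Matrix (Fin d) (Fin d) ℂ) : (D.channel X).trace = X.trace := by
  simp only [channel, Matrix.trace_sum, Matrix.trace_smul, (D.state_isDensityMatrix _).2,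
    smul_eq_mul, mul_one]
  rw [← Matrix.trace_sum, ← Finset.sum_mul, D.sum_effect, one_mul]

theorem channel_one (h : D.IsParallelUpdate) : D.channel 1 = 1 := by
  simp only [channel, mul_one]
  rw [← D.sum_effect]
  exact Finset.sum_congr rfl fun i _ => (h i).symm

theorem trace_channel_mul (X Y : Matrix (Fin d) (Fin d) ℂ) :
    (D.channel X * Y).trace = ∑ i, (D.effect i * X).trace * (D.state i * Y).trace := by
  simp only [channel, Finset.sum_mul, Matrix.trace_sum, Matrix.smul_mul, Matrix.trace_smul,
    smul_eq_mul]

theorem trace_channel_mul_comm (h : D.IsParallelUpdate) (X Y : Matrix (Fin d) (Fin d) ℂ) :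
    (D.channel X * Y).trace = (D.channel Y * X).trace := by
  rw [trace_channel_mul, trace_channel_mul]
  refine Finset.sum_congr rfl fun i _ => ?_
  rw [h i, Matrix.smul_mul, Matrix.smul_mul, Matrix.trace_smul, Matrix.trace_smul, smul_eq_mul,
    smul_eq_mul]
  ring

/-- The weighted sum in the definition of a weight-morphophoric measurement is the quadratic form
of the channel. -/
theorem sum_sq_div_weight (h : D.IsParallelUpdate) (hd : 1 ≤ d) {X : Matrix (Fin d) (Fin d) ℂ}
    (hX : X.IsHermitian) :
    ((∑ i, ((D.effect i * X).trace.re) ^ 2 / D.weight i : ℝ) : ℂ) =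
      d * (D.channel X * X).trace := by
  rw [trace_channel_mul, Finset.mul_sum, Complex.ofReal_sum]
  refine Finset.sum_congr rfl fun i _ => ?_
  rw [Complex.ofReal_div, Complex.ofReal_pow,
    (D.effect_posSemidef i).isHermitian.ofReal_re_trace_mul hX, h.effect_eq hd i,
    Matrix.smul_mul, Matrix.trace_smul, smul_eq_mul]
  -- At weight zero the effect vanishes, and division by zero gives `0` on the left as well.
  rcases eq_or_ne (D.weight i : ℂ) 0 with h0 | h0
  · simp [h0]
  · field_simp

/-- The superoperator trace of the channel of a pure device with parallel update fixes the
depolarizing parameter. -/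
theorem IsDepolarizing.param_eq {p : ℝ} (h : D.IsDepolarizing p) (hpure : D.IsPure)
    (hpar : D.IsParallelUpdate) (hd : 1 ≤ d) : (d : ℝ) = p * d ^ 2 + (1 - p) := by
  have hd0 : (d : ℂ) ≠ 0 := by exact_mod_cast (by lia : d ≠ 0)
  have h1 : ∑ a, ∑ b, D.channel (Matrix.single a b 1) a b = d := by
    calc _ = ∑ i, (D.effect i * D.state i).trace := by
          simp only [channel, Matrix.sum_apply, Matrix.smul_apply, Matrix.trace_mul_single,
            MulOpposite.op_one, one_smul, smul_eq_mul]
          simp only [Matrix.trace, Matrix.diag, Matrix.mul_apply]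
          rw [Finset.sum_comm]
          simp_rw [Finset.sum_comm (s := (Finset.univ : Finset (Fin d)))
            (t := (Finset.univ : Finset (Fin n)))]
      -- Purity enters here: `E_i S_i = tr(E_i) S_i² = E_i`.
      _ = ∑ i, (D.effect i).trace := Finset.sum_congr rfl fun i _ => by
          conv_lhs => rw [hpar i]
          rw [Matrix.smul_mul, (hpure i).mul_self, ← hpar i]
      _ = d := by rw [← Matrix.trace_sum, D.sum_effect]; simp
  have h2 : ∑ a, ∑ b, D.channel (Matrix.single a b 1) a b = p * d ^ 2 + (1 - p) := by
    have h3 (a b : Fin d) : D.channel (Matrix.single a b 1) a b =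
        p + if a = b then (1 - p : ℂ) / d else 0 := by
      rw [h]
      rcases eq_or_ne a b with rfl | hab
      · simp; ring
      · simp [hab]
    simp only [h3, Finset.sum_add_distrib]
    simp
    field_simp
  rw [h1] at h2
  exact_mod_cast h2

/-- In dimension one `X = tr(X) 1`, so the parameter is invisible. -/
theorem IsDepolarizing.of_eq_one {p : ℝ} (h : D.IsDepolarizing p) (hd : d = 1) (q : ℝ) :
    D.IsDepolarizing q := by
  subst hd
  intro X
  rw [h X]
  ext i j
  obtain rfl := Subsingleton.elim i 0
  obtain rfl := Subsingleton.elim j 0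
  simp [Matrix.trace]
  ring

theorem IsDepolarizing.inv_succ {p : ℝ} (h : D.IsDepolarizing p) (hpure : D.IsPure)
    (hpar : D.IsParallelUpdate) (hd : 1 ≤ d) : D.IsDepolarizing (1 / ((d : ℝ) + 1)) := by
  rcases hd.eq_or_lt with h1 | h2
  · exact h.of_eq_one h1.symm _
  · have hp := h.param_eq hpure hpar hd
    have hd1 : (d : ℝ) - 1 ≠ 0 := sub_ne_zero.2 (by exact_mod_cast h2.ne')
    have hp' : p = 1 / ((d : ℝ) + 1) := by
      rw [eq_div_iff (by positivity)]
      apply mul_right_cancel₀ hd1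
      linear_combination -hp
    rwa [← hp']

/-- For `p = 1/(d+1)` the coefficients `p` and `(1 - p)/d` coincide, so the depolarizing map is `d`
times the right-hand side of the frame formula. -/
theorem isDepolarizing_inv_succ_iff (hpar : D.IsParallelUpdate) (hd : 1 ≤ d) :
    D.IsDepolarizing (1 / ((d : ℝ) + 1)) ↔
      ∑ i, (D.weight i : ℂ) • (D.state i ⊗ₖ D.state i) =
        (2 / ((d : ℂ) * (d + 1))) • symProjector d := by
  have hd0 : (d : ℂ) ≠ 0 := by exact_mod_cast (by lia : d ≠ 0)
  have hd1 : (d : ℂ) + 1 ≠ 0 := by exact_mod_cast d.succ_ne_zero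
  rw [sum_kronecker_eq_symProjector_iff, IsDepolarizing]
  refine forall_congr' fun X => ?_
  rw [channel_eq hpar hd]
  have e : ((1 / ((d : ℝ) + 1) : ℝ) : ℂ) • X +
      ((1 - ((1 / ((d : ℝ) + 1) : ℝ) : ℂ)) * (X.trace / d)) • (1 : Matrix (Fin d) (Fin d) ℂ) =
      (d : ℂ) • (1 / ((d : ℂ) * (d + 1))) • (X + X.trace • 1) := by
    simp only [smul_add, smul_smul]
    push_cast
    congr 2 <;> field_simp
    ring
  rw [e]
  exact (smul_right_injective _ hd0).eq_iff

theorem IsDepolarizing.isWeightMorphophoric {p : ℝ} (h : D.IsDepolarizing p) (hp : 0 < p)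
    (hpar : D.IsParallelUpdate) (hd : 1 ≤ d) : D.IsWeightMorphophoric := by
  have hd0 : (0 : ℝ) < d := by exact_mod_cast hd
  refine ⟨d * p, by positivity, fun X hX htr => ?_⟩
  have := sum_sq_div_weight hpar hd hX
  rw [h X, htr] at this
  rw [← Complex.ofReal_inj, this]
  simp [hX.ofReal_re_trace_mul hX, mul_assoc]

theorem IsWeightMorphophoric.exists_isDepolarizing (h : D.IsWeightMorphophoric)
    (hpar : D.IsParallelUpdate) (hd : 1 ≤ d) : ∃ α : ℝ, α ≠ 0 ∧ D.IsDepolarizing (1 / α) := by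
  obtain ⟨k, hk, h⟩ := h
  have hd0 : (d : ℂ) ≠ 0 := by exact_mod_cast (by lia : d ≠ 0)
  refine ⟨d / k, by positivity, ?_⟩
  rw [one_div_div]
  set p : ℂ := ((k / d : ℝ) : ℂ) with hp
  let P : Matrix (Fin d) (Fin d) ℂ →ₗ[ℂ] Matrix (Fin d) (Fin d) ℂ :=
    p • LinearMap.id + ((1 - p) / d) • (Matrix.traceLinearMap (Fin d) ℂ ℂ).smulRight 1
  have hP (X : Matrix (Fin d) (Fin d) ℂ) : P X = p • X + ((1 - p) * (X.trace / d)) • 1 := by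
    simp only [P, LinearMap.add_apply, LinearMap.smul_apply, LinearMap.id_apply,
      LinearMap.smulRight_apply, Matrix.traceLinearMap_apply, smul_smul]
    congr 2
    ring
  -- The difference is self-adjoint, kills `1` and has traceless values on traceless matrices.
  -- Splitting `X = Y + c 1` with `Y` traceless therefore reduces its quadratic form to `Y`, where
  -- morphophoricity makes it vanish.
  have hT : D.channelLinearMap - P = 0 := by
    have hTa (X : Matrix (Fin d) (Fin d) ℂ) : (D.channelLinearMap - P) X =
        D.channel X - (p • X + ((1 - p) * (X.trace / d)) • 1) := by
      rw [← hP]; rfl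
    refine Matrix.superoperator_eq_zero _ (fun X Y => ?_) fun X hX => ?_
    · rw [hTa, hTa]
      simp only [sub_mul, add_mul, Matrix.trace_sub, Matrix.trace_add, Matrix.smul_mul, one_mul,
        Matrix.trace_smul, trace_channel_mul_comm hpar X Y, Matrix.trace_mul_comm X Y, smul_eq_mul]
      ring
    · set c : ℝ := X.trace.re / d with hc
      have hcX : (c : ℂ) * d = X.trace := by
        have := Matrix.isHermitian_one.ofReal_re_trace_mul hX
        rw [one_mul] at this
        rw [hc, Complex.ofReal_div, this, Complex.ofReal_natCast, div_mul_cancel₀ _ hd0]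
      obtain ⟨Y, hY⟩ : ∃ Y, Y = X - (c : ℂ) • (1 : Matrix (Fin d) (Fin d) ℂ) := ⟨_, rfl⟩
      have hYh : Y.IsHermitian := by
        rw [hY]
        refine hX.sub ?_
        simp [Matrix.IsHermitian, Matrix.conjTranspose_smul]
      have hYt : Y.trace = 0 := by
        rw [hY, Matrix.trace_sub, Matrix.trace_smul, ← hcX]
        simp
      have hX' : X = Y + (c : ℂ) • (1 : Matrix (Fin d) (Fin d) ℂ) := by rw [hY]; abel
      have h1 : (D.channelLinearMap - P) 1 = 0 := by
        rw [hTa, channel_one hpar, Matrix.trace_one, Fintype.card_fin, div_self hd0, ← add_smul]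
        simp
      have h2 : (D.channel Y * Y).trace = p * (Y * Y).trace := by
        have h3 := sum_sq_div_weight hpar hd hYh
        rw [h Y hYh hYt, Complex.ofReal_mul, hYh.ofReal_re_trace_mul hYh] at h3
        apply mul_left_cancel₀ hd0
        rw [← h3, hp]
        push_cast
        field_simp
      have h4 : ((D.channelLinearMap - P) Y).trace = 0 := by
        rw [hTa, hYt]
        simp [trace_channel, hYt]
      rw [hX', map_add, map_smul, h1, smul_zero, add_zero, mul_add, Matrix.trace_add,
        Matrix.mul_smul, mul_one, Matrix.trace_smul, h4, smul_zero, add_zero, hTa, hYt]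
      simp [sub_mul, h2]
  intro X
  rw [← hP, ← sub_eq_zero]
  exact LinearMap.congr_fun hT X

theorem isWeightedProjectiveTwoDesign (hd : 1 ≤ d) (hpure : D.IsPure)
    (h : ∑ i, (D.weight i : ℂ) • (D.state i ⊗ₖ D.state i) =
      (2 / ((d : ℂ) * (d + 1))) • symProjector d) :
    IsWeightedProjectiveTwoDesign D.weight D.state :=
  ⟨weight_nonneg, sum_weight hd, hpure, h.trans (haarAverage_eq hd).symm⟩

end MeasurePrepareDevice

/-! ### From weighted 2-designs to reference devices. -/

theorem Submodule.span_range_eq_selfAdjoint_of_le {n d : ℕ}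
    {S T : Fin n → Matrix (Fin d) (Fin d) ℂ} (hT : ∀ i, (T i).IsHermitian)
    (hS : selfAdjoint.submodule ℝ (Matrix (Fin d) (Fin d) ℂ) ≤ span ℝ (Set.range S))
    (hST : ∀ i, S i ∈ span ℝ (Set.range T)) :
    span ℝ (Set.range T) = selfAdjoint.submodule ℝ (Matrix (Fin d) (Fin d) ℂ) := by
  refine le_antisymm (span_le.2 ?_) (hS.trans (span_le.2 ?_))
  · rintro _ ⟨i, rfl⟩
    exact hT i
  · rintro _ ⟨i, rfl⟩
    exact hST i

namespace IsWeightedProjectiveTwoDesign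

open MeasurePrepareDevice

variable {n d : ℕ} {w : Fin n → ℝ} {S : Fin n → Matrix (Fin d) (Fin d) ℂ}

theorem sum_trace_smul (h : IsWeightedProjectiveTwoDesign w S) (hd : 1 ≤ d)
    (X : Matrix (Fin d) (Fin d) ℂ) : ∑ i, ((w i : ℂ) * (S i * X).trace) • S i =
      (1 / ((d : ℂ) * (d + 1))) • (X + X.trace • 1) :=
  (sum_kronecker_eq_symProjector_iff _ _).1 (h.2.2.2.trans (haarAverage_eq hd)) X

/-- The frame formula at `X = 1`; it makes the rescaled states a POVM. -/
theorem sum_smul (h : IsWeightedProjectiveTwoDesign w S) (hd : 1 ≤ d) :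
    ∑ i, ((d : ℂ) * w i) • S i = 1 := by
  have hd0 : (d : ℂ) ≠ 0 := by exact_mod_cast (by lia : d ≠ 0)
  have hd1 : (d : ℂ) + 1 ≠ 0 := by exact_mod_cast d.succ_ne_zero
  have h1 := congrArg ((d : ℂ) • ·) (h.sum_trace_smul hd 1)
  simp only [Finset.smul_sum, smul_smul, mul_one, (h.2.2.1 _).isDensityMatrix.2,
    Matrix.trace_one, Fintype.card_fin] at h1
  rw [h1, ← one_smul ℂ (1 : Matrix (Fin d) (Fin d) ℂ), smul_smul, ← add_smul, smul_smul]
  congr 1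
  field_simp
  ring

/-- The measure-and-prepare device of a weighted 2-design. -/
def device (h : IsWeightedProjectiveTwoDesign w S) (hd : 1 ≤ d) : MeasurePrepareDevice n d where
  effect i := ((d : ℂ) * w i) • S i
  state := S
  effect_posSemidef i := (h.2.2.1 i).isDensityMatrix.1.smul (by
    have := h.1 i
    exact_mod_cast (by positivity : (0 : ℝ) ≤ d * w i))
  sum_effect := h.sum_smul hd
  state_isDensityMatrix i := (h.2.2.1 i).isDensityMatrix

variable (h : IsWeightedProjectiveTwoDesign w S) (hd : 1 ≤ d)

theorem trace_device_effect (i : Fin n) : ((h.device hd).effect i).trace = (d : ℂ) * w i := by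
  simp [device, (h.2.2.1 i).isDensityMatrix.2]

theorem device_weight : (h.device hd).weight = w := by
  have hd0 : (d : ℝ) ≠ 0 := by exact_mod_cast (by lia : d ≠ 0)
  ext i
  rw [weight, trace_device_effect]
  simp [hd0]

theorem device_isParallelUpdate : (h.device hd).IsParallelUpdate := fun i => by
  rw [trace_device_effect]
  rfl

/-- Solving the frame formula for `X`, and writing `1` as the sum of the effects, expands `X` in the
effects. The coefficients are real because `X` and the states are Hermitian. -/
theorem selfAdjoint_le_span_device_effect :
    selfAdjoint.submodule ℝ (Matrix (Fin d) (Fin d) ℂ) ≤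
      Submodule.span ℝ (Set.range (h.device hd).effect) := by
  have hd0 : (d : ℂ) ≠ 0 := by exact_mod_cast (by lia : d ≠ 0)
  have hd1 : (d : ℂ) + 1 ≠ 0 := by exact_mod_cast d.succ_ne_zero
  intro X hX
  replace hX : X.IsHermitian := hX
  have htr : (X.trace.re : ℂ) = X.trace := by
    simpa using Matrix.isHermitian_one.ofReal_re_trace_mul hX
  have key : X = ∑ i, (((d : ℝ) + 1) * (S i * X).trace.re - X.trace.re) •
      (h.device hd).effect i := by
    calc X = ((d : ℂ) * (d + 1)) • ((1 / ((d : ℂ) * (d + 1))) • (X + X.trace • 1)) -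
          X.trace • (1 : Matrix (Fin d) (Fin d) ℂ) := by
          rw [smul_smul, mul_one_div_cancel (mul_ne_zero hd0 hd1)]
          simp
      _ = _ := by
          rw [← h.sum_trace_smul hd X, ← h.sum_smul hd, Finset.smul_sum, Finset.smul_sum,
            ← Finset.sum_sub_distrib]
          refine Finset.sum_congr rfl fun i _ => ?_
          rw [← Complex.coe_smul]
          push_cast
          rw [htr, (h.2.2.1 i).isDensityMatrix.1.isHermitian.ofReal_re_trace_mul hX]
          simp only [device, smul_smul, ← sub_smul]
          congr 1
          ring
  rw [key]
  exact Submodule.sum_mem _ fun i _ =>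
    Submodule.smul_mem _ _ (Submodule.subset_span (Set.mem_range_self i))

theorem device_isPureWeightMorphophoricReferenceDevice :
    (h.device hd).IsPureWeightMorphophoricReferenceDevice := by
  have hpar := h.device_isParallelUpdate hd
  have hspan := h.selfAdjoint_le_span_device_effect hd
  refine ⟨⟨?_, ?_⟩, h.2.2.1, hpar, ?_⟩
  · exact Submodule.span_range_eq_selfAdjoint_of_le
      (fun i => ((h.device hd).effect_posSemidef i).isHermitian) hspan
      fun i => Submodule.subset_span (Set.mem_range_self i)
  · refine Submodule.span_range_eq_selfAdjoint_of_le
      (fun i => ((h.device hd).state_isDensityMatrix i).1.isHermitian) hspan fun i => ?_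
    have e : (h.device hd).effect i = ((d : ℝ) * w i) • (h.device hd).state i := by
      rw [← Complex.coe_smul]
      simp [device]
    rw [e]
    exact Submodule.smul_mem _ _ (Submodule.subset_span (Set.mem_range_self i))
  · refine ((isDepolarizing_inv_succ_iff hpar hd).2 ?_).isWeightMorphophoric
      (by positivity) hpar hd
    rw [h.device_weight hd]
    exact h.2.2.2.trans (haarAverage_eq hd)

end IsWeightedProjectiveTwoDesign

end

theorem mainTheorem3 (d : ℕ) (hd : 1 ≤ d) :
    haarAverage d = (2 / ((d : ℂ) * (d + 1))) • symProjector d ∧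
    (∀ (n : ℕ) (D : MeasurePrepareDevice n d), D.IsPure → D.IsParallelUpdate →
      (∀ α : ℝ, D.IsDepolarizing (1 / α) →
        (2 ≤ d → α = d + 1) ∧
        ∑ i, (D.weight i : ℂ) • (D.state i ⊗ₖ D.state i) =
          (2 / ((d : ℂ) * (d + 1))) • symProjector d ∧
        IsWeightedProjectiveTwoDesign D.weight D.state) ∧
      (D.IsWeightMorphophoric ↔ ∃ α : ℝ, α ≠ 0 ∧ D.IsDepolarizing (1 / α))) ∧
    (∀ (n : ℕ) (w : Fin n → ℝ) (S : Fin n → Matrix (Fin d) (Fin d) ℂ),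
      IsWeightedProjectiveTwoDesign w S ↔
        ∃! D : MeasurePrepareDevice n d,
          D.IsPureWeightMorphophoricReferenceDevice ∧ D.weight = w ∧ D.state = S) := by
  have design (n : ℕ) (D : MeasurePrepareDevice n d) (hpure : D.IsPure)
      (hpar : D.IsParallelUpdate) (p : ℝ) (h : D.IsDepolarizing p) :
      ∑ i, (D.weight i : ℂ) • (D.state i ⊗ₖ D.state i) =
        (2 / ((d : ℂ) * (d + 1))) • symProjector d :=
    (MeasurePrepareDevice.isDepolarizing_inv_succ_iff hpar hd).1 (h.inv_succ hpure hpar hd)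
  refine ⟨haarAverage_eq hd, fun n D hpure hpar => ⟨fun α h => ⟨fun h2 => ?_, ?_⟩, ?_, ?_⟩,
    fun n w S => ⟨fun h => ?_, ?_⟩⟩
  · have hp := h.param_eq hpure hpar hd
    have hd1 : (d : ℝ) - 1 ≠ 0 := sub_ne_zero.2 (by exact_mod_cast (by lia : d ≠ 1))
    -- As `1 / 0 = 0`, the value `α = 0` would mean `p = 0`, and the trace identity would give `d =
    -- 1`.
    have hα : α ≠ 0 := by
      rintro rfl
      apply hd1
      rw [hp]
      simp
    field_simp at hp
    apply mul_right_cancel₀ hd1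
    linear_combination hp
  · have := design n D hpure hpar _ h
    exact ⟨this, MeasurePrepareDevice.isWeightedProjectiveTwoDesign hd hpure this⟩
  · exact fun h => h.exists_isDepolarizing hpar hd
  · rintro ⟨α, -, h⟩
    -- Passing to `1/(d+1)` supplies a positive parameter even if `α < 0`, which can happen for `d =
    -- 1`.
    exact (h.inv_succ hpure hpar hd).isWeightMorphophoric (by positivity) hpar hd
  · refine ⟨h.device hd, ⟨h.device_isPureWeightMorphophoricReferenceDevice hd,
      h.device_weight hd, rfl⟩, ?_⟩
    -- Uniqueness: proportionality forces `E_i = d w_i S_i`.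
    rintro D ⟨⟨-, -, hpar, -⟩, rfl, rfl⟩
    refine MeasurePrepareDevice.ext (funext fun i => ?_) rfl
    exact hpar.effect_eq hd i
  · rintro ⟨D, ⟨⟨-, hpure, hpar, hwm⟩, rfl, rfl⟩, -⟩
    obtain ⟨α, -, h⟩ := hwm.exists_isDepolarizing hpar hd
    exact MeasurePrepareDevice.isWeightedProjectiveTwoDesign hd hpure (design n D hpure hpar _ h)
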